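/- Let $\mathcal V$ be a symmetric monoidal closed category whose underlying ordinary category $\mathcal V_0$ is locally presentable. Fix a regular cardinal $\lambda_0$ such that $\mathcal V_0$ is locally $\lambda_0$-presentable, the unit object $I$ is $\lambda_0$-presentable, and the tensor product of two $\lambda_0$-presentable objects is $\lambda_0$-presentable (such a $\lambda_0$ always exists). Let $\mathcal G$ be a (small) strong generator of $\mathcal V_0$. For a $\mathcal V$-category $\mathcal C$ with underlying ordinary category $\mathcal C_0$, a conical colimit in $\mathcal C$ is a colimit in $\mathcal C_0$ that is preserved by $\mathcal C(-,Y)_0\colon \mathcal C_0\to\mathcal V_0^{\mathrm{op}}$ for every $Y\in\mathcal C$; $\lambda$-filtered colimits in $\mathcal C$ are conical colimits indexed by small $\lambda$-filtered categories. An object $X\in\mathcal C$ is $\lambda$-presentable if $\mathcal C(X,-)\colon\mathcal C\to\mathcal V$ preserves $\lambda$-filtered colimits. The $\mathcal V$-category $\mathcal C$ is $\lambda$-accessible if it admits $\lambda$-filtered colimits and there is a small set of $\lambda$-presentable objects such that every object of $\mathcal C$ is a $\lambda$-filtered colimit of objects in that set; it is accessible if it is $\lambda$-accessible for some regular cardinal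 $\lambda\ge\lambda_0$. A power of $X\in\mathcal C$ by $G\in\mathcal V$ is an object $G\pitchfork X$ with a morphism $G\to\mathcal C(G\pitchfork X,X)$ inducing isomorphisms $\mathcal C(B,G\pitchfork X)\cong[G,\mathcal C(B,X)]$ in $\mathcal V$ for all $B\in\mathcal C$. Let $\mathcal A$ and $\mathcal C$ be $\mathcal V$-categories with powers by the objects of $\mathcal G$, and let $U\colon\mathcal A\to\mathcal C$ be a $\mathcal V$-functor which preserves these powers and is conservative (that is, its underlying functor $U_0\colon\mathcal A_0\to\mathcal C_0$ reflects isomorphisms). Suppose that $\mathcal C$ is an accessible $\mathcal V$-category, that $\mathcal A_0$ is an accessible category, and that $U_0$ is an accessible functor (that is, it preserves $\lambda$-filtered colimits for some regular cardinal $\lambda$). Then $\mathcal A$ is an accessible $\mathcal V$-category. -/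

import Mathlib

universe w u u₁ u₂

namespace EnrichedAccessibility

open CategoryTheory Limits MonoidalCategory Opposite

section Base

variable (V : Type u) [Category.{w} V] [MonoidalCategory V]

/-- `κ` is a regular cardinal that is admissible as a lower bound for the cardinals used in the
`V`-enriched theory of accessibility: `V` is locally `κ`-presentable, the unit object is
`κ`-presentable, and the tensor product of two `κ`-presentable objects is `κ`-presentable. -/
structure IsBaseCardinal (κ : Cardinal.{w}) [Fact κ.IsRegular] : Prop where
  isCardinalLocallyPresentable : IsCardinalLocallyPresentable V κ
  isCardinalPresentable_unit : IsCardinalPresentable (𝟙_ V) κ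
  isCardinalPresentable_tensor (X Y : V) :
    IsCardinalPresentable X κ → IsCardinalPresentable Y κ → IsCardinalPresentable (X ⊗ Y) κ

/-- Base cardinals exist as soon as the symmetric monoidal closed category `V` is locally
presentable. -/
theorem exists_isBaseCardinal [SymmetricCategory V] [MonoidalClosed V]
    [IsLocallyPresentable.{w} V] :
    ∃ (κ : Cardinal.{w}) (_ : Fact κ.IsRegular), IsBaseCardinal V κ := by
  obtain ⟨κ₁, _, h₁⟩ := IsLocallyPresentable.exists_cardinal.{w} V
  obtain ⟨P, _, hP, hP'⟩ := (IsCardinalLocallyPresentable.iff_exists_isStrongGenerator V κ₁).1 h₁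
  have pres : ∀ X : V, ∃ (κ : Cardinal.{w}) (_ : Fact κ.IsRegular), IsCardinalPresentable X κ :=
    fun X => (inferInstance : IsPresentable.{w} X).exists_cardinal
  choose k hk hk' using pres
  let S := Shrink.{w} (Subtype P)
  let f : S → V := fun s => ((equivShrink _).symm s).1
  let g : (Option (S × S)) ⊕ Unit → Cardinal.{w} := Sum.elim (fun o => o.elim (k (𝟙_ V)) (fun p => k (f p.1 ⊗ f p.2))) (fun _ => κ₁)
  obtain ⟨κ, hκ, hlt⟩ := HasCardinalLT.exists_regular_cardinal_forall.{w} (fun i => (g i).ord.ToType)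
  have hle : ∀ i, g i ≤ κ := fun i => le_of_lt (by simpa [hasCardinalLT_iff_cardinal_mk_lt] using hlt i)
  have : Fact κ.IsRegular := ⟨hκ⟩
  have h1 : κ₁ ≤ κ := hle (.inr ())
  have hPκ : P ≤ isCardinalPresentable V κ := hP'.trans (isCardinalPresentable_monotone _ h1)
  have hcl := IsStrongGenerator.colimitsCardinalClosure_eq_isCardinalPresentable hP hPκ
  have : ∀ X : V, (tensorRight X).IsLeftAdjoint := fun X =>
    Functor.isLeftAdjoint_of_iso (BraidedCategory.tensorLeftIsoTensorRight X)
  have key : ∀ (F : V ⥤ V) [PreservesColimitsOfSize.{w,w} F], (∀ X, P X → IsCardinalPresentable (F.obj X) κ) →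
      ∀ X, IsCardinalPresentable X κ → IsCardinalPresentable (F.obj X) κ := by
    intro F _ hF X hX
    have : isCardinalPresentable V κ ≤ (isCardinalPresentable V κ).inverseImage F := by
      conv_lhs => rw [hcl]
      refine P.colimitsCardinalClosure_le κ (fun J _ hJ => ?_) hF
      have := isClosedUnderColimitsOfShape_isCardinalPresentable V (κ := κ) hJ
      infer_instance
    exact this X hX
  refine ⟨κ, ⟨hκ⟩, ⟨IsCardinalLocallyPresentable.of_le V h1, ?_, ?_⟩⟩
  · exact isCardinalPresentable_of_le (κ := k (𝟙_ V)) _ (hle (.inl none))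
  · intro X Y hX hY
    have step : ∀ X, P X → ∀ Y, IsCardinalPresentable Y κ → IsCardinalPresentable (X ⊗ Y) κ := by
      intro X hX
      refine key (tensorLeft X) (fun Y hY => ?_)
      have := hle (.inl (some (equivShrink _ ⟨X,hX⟩, equivShrink _ ⟨Y,hY⟩)))
      simp [g, f] at this
      exact isCardinalPresentable_of_le (κ := k (X ⊗ Y)) (X ⊗ Y) this
    have := key (tensorRight Y) (fun X hX => step X hX Y hY) X hX
    exact this

end Base

section ConicalColimits

variable (V : Type u) [Category.{w} V] [MonoidalCategory V]
variable {C : Type u₁} [EnrichedCategory V C]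

/-- The functor `C(-, Y)₀ : C₀ ⥤ V₀ᵒᵖ`, where `C₀ = ForgetEnrichment V C` is the underlying
category of the `V`-category `C`. -/
def homInto (Y : ForgetEnrichment V C) : ForgetEnrichment V C ⥤ Vᵒᵖ :=
  ((eHomFunctor V (ForgetEnrichment V C)).flip.obj Y).rightOp

/-- The functor `C(X, -)₀ : C₀ ⥤ V₀`. -/
def homFrom (X : ForgetEnrichment V C) : ForgetEnrichment V C ⥤ V :=
  (eHomFunctor V (ForgetEnrichment V C)).obj (op X)

/-- A cocone in `C₀` is a conical colimit in `C` if it is a colimit in `C₀` which is preserved by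
`C(-, Y)₀ : C₀ ⥤ V₀ᵒᵖ` for every object `Y`. -/
structure IsConicalColimit {J : Type w} [SmallCategory J] {F : J ⥤ ForgetEnrichment V C}
    (c : Cocone F) : Prop where
  isColimit : Nonempty (IsColimit c)
  isColimit_homInto (Y : ForgetEnrichment V C) : Nonempty (IsColimit ((homInto V Y).mapCocone c))

/-- An object `X` of a `V`-category `C` is `κ`-presentable if `C(X, -)` sends `κ`-filtered
(conical) colimits in `C` to colimits in `V`. -/
def IsEnrichedPresentable (X : ForgetEnrichment V C) (κ : Cardinal.{w}) [Fact κ.IsRegular] :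
    Prop :=
  ∀ (J : Type w) [SmallCategory J] [IsCardinalFiltered J κ] (F : J ⥤ ForgetEnrichment V C)
    (c : Cocone F), IsConicalColimit V c → Nonempty (IsColimit ((homFrom V X).mapCocone c))

variable (C)

/-- A `V`-category `C` is `κ`-accessible if it has `κ`-filtered (conical) colimits and a small set
`S` of `κ`-presentable objects such that every object is a `κ`-filtered (conical) colimit of
objects in `S`. -/
structure IsCardinalAccessibleVCategory (κ : Cardinal.{w}) [Fact κ.IsRegular] : Prop where
  exists_conicalColimit (J : Type w) [SmallCategory J] [IsCardinalFiltered J κ]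
    (F : J ⥤ ForgetEnrichment V C) : ∃ c : Cocone F, IsConicalColimit V c
  exists_generator : ∃ (S : ObjectProperty (ForgetEnrichment V C)),
    ObjectProperty.Small.{w} S ∧
    (∀ X, S X → IsEnrichedPresentable V X κ) ∧
    ∀ X : ForgetEnrichment V C, ∃ (J : Type w) (_ : SmallCategory J) (_ : IsCardinalFiltered J κ)
      (F : J ⥤ ForgetEnrichment V C) (c : Cocone F),
      (∀ j, S (F.obj j)) ∧ IsConicalColimit V c ∧ c.pt = X

/-- A `V`-category is accessible, relative to a base cardinal `κ₀`, if it is `κ`-accessible for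
some regular cardinal `κ ≥ κ₀`. -/
def IsAccessibleVCategory (κ₀ : Cardinal.{w}) : Prop :=
  ∃ (κ : Cardinal.{w}) (_ : Fact κ.IsRegular), κ₀ ≤ κ ∧ IsCardinalAccessibleVCategory V C κ

end ConicalColimits

section Powers

variable {V : Type u} [Category.{w} V] [MonoidalCategory V] [SymmetricCategory V]
  [MonoidalClosed V]
variable {C : Type u₁} [EnrichedCategory V C]

/-- Given `ε : G ⟶ C(P, X)`, the comparison morphism `C(B, P) ⟶ [G, C(B, X)]` in `V` which is
the transpose of `G ⊗ C(B, P) ≅ C(B, P) ⊗ G ⟶ C(B, P) ⊗ C(P, X) ⟶ C(B, X)`. -/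
def powerComparison {G : V} {P X : C} (ε : G ⟶ (EnrichedCategory.Hom P X : V)) (B : C) :
    (EnrichedCategory.Hom B P : V) ⟶ (ihom G).obj (EnrichedCategory.Hom B X) :=
  MonoidalClosed.curry
    ((β_ G (EnrichedCategory.Hom B P)).hom ≫ (EnrichedCategory.Hom B P) ◁ ε ≫ eComp V B P X)

/-- `ε : G ⟶ C(P, X)` exhibits `P` as the power `G ⋔ X` of `X` by `G` in the `V`-category `C`:
the (automatically `V`-natural) comparison `C(B, P) ⟶ [G, C(B, X)]` is invertible for all `B`. -/
def IsPower {G : V} {P X : C} (ε : G ⟶ (EnrichedCategory.Hom P X : V)) : Prop :=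
  ∀ B : C, IsIso (powerComparison ε B)

variable (C) in
/-- The `V`-category `C` has powers by all the objects in `𝒢`. -/
def HasPowersBy (𝒢 : ObjectProperty V) : Prop :=
  ∀ (G : V), 𝒢 G → ∀ X : C, ∃ (P : C) (ε : G ⟶ (EnrichedCategory.Hom P X : V)), IsPower ε

/-- The `V`-functor `U` preserves powers by the objects in `𝒢`. -/
def PreservesPowersBy {D : Type u₂} [EnrichedCategory V D] (U : EnrichedFunctor V C D)
    (𝒢 : ObjectProperty V) : Prop :=
  ∀ (G : V), 𝒢 G → ∀ (P X : C) (ε : G ⟶ (EnrichedCategory.Hom P X : V)),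
    IsPower ε → IsPower (ε ≫ U.map P X)

end Powers

end EnrichedAccessibility

namespace EnrichedAccessibility

open CategoryTheory Limits MonoidalCategory Opposite

/-! ### Raising the index of accessibility -/

section RaisingIndex

universe v

/-- Above any cardinal there is a regular `κ'` such that every set of cardinality `< κ'` has fewer
than `κ'` subsets of cardinality `< κ`. -/
theorem exists_isRegular_hasCardinalLT_setCardinalLT (κ μ : Cardinal.{w}) [Fact κ.IsRegular] :
    ∃ (κ' : Cardinal.{w}) (_ : Fact κ'.IsRegular), κ < κ' ∧ μ ≤ κ' ∧
      ∀ X : Type w, HasCardinalLT X κ' →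
        HasCardinalLT (CardinalDirectedPoset.SetCardinalLT κ X) κ' := by
  have hκ : Cardinal.aleph0 ≤ κ := Cardinal.IsRegular.aleph0_le Fact.out
  let α := max κ μ
  have hα : Cardinal.aleph0 ≤ α := hκ.trans (le_max_left _ _)
  have hα' : Cardinal.aleph0 ≤ 2 ^ α := hα.trans (Cardinal.cantor α).le
  -- Sets of size below this successor have size at most `2 ^ α`, and `(2 ^ α) ^ α = 2 ^ α`.
  refine ⟨Order.succ (2 ^ α), ⟨Cardinal.isRegular_succ hα'⟩, ?_, ?_, fun X hX => ?_⟩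
  · exact (le_max_left _ _).trans_lt ((Cardinal.cantor α).trans (Order.lt_succ _))
  · exact ((le_max_right _ _).trans_lt ((Cardinal.cantor α).trans (Order.lt_succ _))).le
  · rw [hasCardinalLT_iff_cardinal_mk_lt, Order.lt_succ_iff] at hX ⊢
    calc Cardinal.mk (CardinalDirectedPoset.SetCardinalLT κ X)
        ≤ Cardinal.mk { t : Set X // Cardinal.mk t ≤ α } :=
          Cardinal.mk_subtype_mono fun t ht =>
            ((hasCardinalLT_iff_cardinal_mk_lt _ _).1 ht).le.trans (le_max_left _ _)
      _ ≤ max (Cardinal.mk X) Cardinal.aleph0 ^ α := Cardinal.mk_bounded_set_le X α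
      _ ≤ (2 ^ α) ^ α := Cardinal.power_le_power_right (max_le hX hα')
      _ = 2 ^ α := by rw [← Cardinal.power_mul, Cardinal.mul_eq_self hα]

variable {D : Type u} [Category.{v} D]

theorem hasCardinalFilteredColimits_of_le {κ κ' : Cardinal.{w}} [Fact κ.IsRegular]
    [Fact κ'.IsRegular] (h : κ ≤ κ') [HasCardinalFilteredColimits.{w} D κ] :
    HasCardinalFilteredColimits.{w} D κ' where
  hasColimitsOfShape J _ _ :=
    have := IsCardinalFiltered.of_le J h
    HasCardinalFilteredColimits.hasColimitsOfShape D κ J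

theorem hasCardinalLT_arrow_of_preorder {J : Type w} [Preorder J] {κ : Cardinal.{w}}
    (hκ : Cardinal.aleph0 ≤ κ) (hJ : HasCardinalLT J κ) : HasCardinalLT (Arrow J) κ :=
  (hasCardinalLT_prod hκ hJ hJ).of_injective (fun f => (f.left, f.right)) fun f g h => by
    obtain ⟨a, b, f⟩ := f
    obtain ⟨a', b', g⟩ := g
    simp only [Prod.mk.injEq] at h
    obtain ⟨rfl, rfl⟩ := h
    obtain rfl : f = g := Subsingleton.elim _ _
    rfl

/-! ### Decomposing a colimit over a poset by subsets -/

section Subsets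

theorem mem_of_subtype_hom {α : Type w} {Q : Set α → Prop} {B B' : Subtype Q} (f : B ⟶ B')
    {a : α} (ha : a ∈ B.1) : a ∈ B'.1 :=
  leOfHom f ha

variable {α : Type w} [PartialOrder α] (F : α ⥤ D) (Q : Set α → Prop)
  [∀ B : Subtype Q, HasColimit ((Subtype.mono_coe (· ∈ B.1)).functor ⋙ F)]

variable {Q} in
/-- The cocone for the restriction of a functor to a subset that is given by the colimit over a
larger subset. -/
noncomputable abbrev subsetInclusionCocone {B B' : Subtype Q} (f : B ⟶ B') :
    Cocone ((Subtype.mono_coe (· ∈ B.1)).functor ⋙ F) where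
  pt := colimit ((Subtype.mono_coe (· ∈ B'.1)).functor ⋙ F)
  ι :=
    { app := fun b => colimit.ι ((Subtype.mono_coe (· ∈ B'.1)).functor ⋙ F)
        ⟨b.1, mem_of_subtype_hom f b.2⟩
      naturality := fun b b' g =>
        (colimit.w ((Subtype.mono_coe (· ∈ B'.1)).functor ⋙ F)
          (j := ⟨b'.1, mem_of_subtype_hom f b'.2⟩) (j' := ⟨b.1, mem_of_subtype_hom f b.2⟩)
          (homOfLE (leOfHom g))).trans (Category.comp_id _).symm }

/-- The functor which sends a subset `B` of the partially ordered type `α`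
to the colimit of the restriction to `B` of a given functor. -/
noncomputable def subsetColimitFunctor : Subtype Q ⥤ D where
  obj B := colimit ((Subtype.mono_coe (· ∈ B.1)).functor ⋙ F)
  map f := colimit.desc _ (subsetInclusionCocone F f)
  map_id B := colimit.hom_ext fun a => (colimit.ι_desc _ _).trans (Category.comp_id _).symm
  map_comp {_ B' _} f g := colimit.hom_ext fun a => by
    rw [colimit.ι_desc, ← Category.assoc, colimit.ι_desc]
    exact (colimit.ι_desc (subsetInclusionCocone F g) ⟨a.1, mem_of_subtype_hom f a.2⟩).symm

/-- The canonical morphism from a value of the functor to the colimit over a subset. -/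
noncomputable def ιSubsetColimit (B : Subtype Q) (a : α) (ha : a ∈ B.1) :
    F.obj a ⟶ (subsetColimitFunctor F Q).obj B :=
  colimit.ι ((Subtype.mono_coe (· ∈ B.1)).functor ⋙ F) ⟨a, ha⟩

variable {F Q} in
theorem subsetColimit_hom_ext {B : Subtype Q} {X : D}
    {f g : (subsetColimitFunctor F Q).obj B ⟶ X}
    (h : ∀ a ha, ιSubsetColimit F Q B a ha ≫ f = ιSubsetColimit F Q B a ha ≫ g) : f = g :=
  colimit.hom_ext fun a => h a.1 a.2

theorem ιSubsetColimit_map {B B' : Subtype Q} (f : B ⟶ B') (a : α) (ha : a ∈ B.1) :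
    ιSubsetColimit F Q B a ha ≫ (subsetColimitFunctor F Q).map f =
      ιSubsetColimit F Q B' a (mem_of_subtype_hom f ha) :=
  colimit.ι_desc _ _

theorem map_ιSubsetColimit (B : Subtype Q) {a a' : α} (g : a ⟶ a') (ha : a ∈ B.1)
    (ha' : a' ∈ B.1) :
    F.map g ≫ ιSubsetColimit F Q B a' ha' = ιSubsetColimit F Q B a ha :=
  colimit.w ((Subtype.mono_coe (· ∈ B.1)).functor ⋙ F)
    (j := ⟨a', ha'⟩) (j' := ⟨a, ha⟩) (homOfLE (leOfHom g))

variable {F}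

/-- The morphism from the colimit over a subset to the point of a cocone. -/
noncomputable def descSubsetColimit (c : Cocone F) (B : Subtype Q) :
    (subsetColimitFunctor F Q).obj B ⟶ c.pt :=
  colimit.desc ((Subtype.mono_coe (· ∈ B.1)).functor ⋙ F)
    (c.whisker (Subtype.mono_coe (· ∈ B.1)).functor)

theorem ι_descSubsetColimit (c : Cocone F) (B : Subtype Q) (a : α) (ha : a ∈ B.1) :
    ιSubsetColimit F Q B a ha ≫ descSubsetColimit Q c B = c.ι.app a :=
  colimit.ι_desc _ _

/-- A cocone for a functor induces a cocone for the functor of colimits over subsets. -/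
noncomputable abbrev subsetColimitCocone (c : Cocone F) : Cocone (subsetColimitFunctor F Q) where
  pt := c.pt
  ι :=
    { app := fun B => descSubsetColimit Q c B
      naturality := fun B B' f => subsetColimit_hom_ext fun a ha => by
        dsimp only [Functor.const_obj_obj, Functor.const_obj_map]
        rw [← Category.assoc, ιSubsetColimit_map, Category.comp_id, ι_descSubsetColimit,
          ι_descSubsetColimit] }

variable {Q} in
/-- If the subsets satisfying `Q` are directed and cover `α`, the colimit of a functor is
the colimit of its colimits over these subsets. -/
theorem nonempty_isColimit_subsetColimitCocone {c : Cocone F} (hc : IsColimit c)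
    (hQ : ∀ B B' : Subtype Q, ∃ B'' : Subtype Q, B ≤ B'' ∧ B' ≤ B'')
    (hQ' : ∀ a : α, ∃ B : Subtype Q, a ∈ B.1) :
    Nonempty (IsColimit (subsetColimitCocone Q c)) := by
  choose β hβ using hQ'
  -- By directedness, the leg at `a` does not depend on the chosen subset containing `a`.
  have indep (s : Cocone (subsetColimitFunctor F Q)) (a : α) (B B' : Subtype Q)
      (h : a ∈ B.1) (h' : a ∈ B'.1) :
      ιSubsetColimit F Q B a h ≫ s.ι.app B = ιSubsetColimit F Q B' a h' ≫ s.ι.app B' := by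
    obtain ⟨B'', h₁, h₂⟩ := hQ B B'
    rw [← s.w (homOfLE h₁), ← s.w (homOfLE h₂), ← Category.assoc, ← Category.assoc,
      ιSubsetColimit_map, ιSubsetColimit_map]
  let t (s : Cocone (subsetColimitFunctor F Q)) : Cocone F :=
    { pt := s.pt
      ι :=
        { app := fun a => ιSubsetColimit F Q (β a) a (hβ a) ≫ s.ι.app (β a)
          naturality := fun a a' g => by
            obtain ⟨B, h₁, h₂⟩ := hQ (β a) (β a')
            dsimp
            rw [indep s a (β a) B (hβ a) (h₁ (hβ a)), indep s a' (β a') B (hβ a') (h₂ (hβ a')),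
              ← Category.assoc, map_ιSubsetColimit F Q B g (h₁ (hβ a)) (h₂ (hβ a')),
              Category.comp_id] } }
  refine ⟨{
    desc := fun s => hc.desc (t s)
    fac := fun s B => subsetColimit_hom_ext fun a ha => ?_
    uniq := fun s m hm => hc.hom_ext fun a => ?_ }⟩
  · rw [← Category.assoc, ι_descSubsetColimit, hc.fac]
    exact indep s a _ _ _ _
  · rw [hc.fac, ← ι_descSubsetColimit Q c (β a) a (hβ a), Category.assoc]
    exact congrArg _ (hm (β a))

end Subsets

/-- An accessible category is `κ'`-accessible for arbitrarily large regular cardinals `κ'`. -/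
theorem exists_isCardinalAccessibleCategory_ge (D : Type u) [Category.{v} D]
    [IsAccessibleCategory.{w} D] (μ : Cardinal.{w}) :
    ∃ (κ' : Cardinal.{w}) (_ : Fact κ'.IsRegular), μ ≤ κ' ∧ IsCardinalAccessibleCategory D κ' := by
  obtain ⟨κ, _, _⟩ := IsAccessibleCategory.exists_cardinal.{w} D
  obtain ⟨κ', _, hκ, hμ, hκ'⟩ := exists_isRegular_hasCardinalLT_setCardinalLT κ μ
  have aleph0_le : Cardinal.aleph0 ≤ κ' := Cardinal.IsRegular.aleph0_le Fact.out
  refine ⟨κ', inferInstance, hμ, ?_⟩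
  obtain ⟨P, _, hP⟩ := HasCardinalFilteredGenerator.exists_generator D κ
  have := hasCardinalFilteredColimits_of_le (D := D) hκ.le
  -- Regroup a `κ`-directed colimit of objects of `P` along the `κ`-directed subsets of size `< κ'`:
  -- their partial colimits exist, are `κ'`-presentable, and form a `κ'`-filtered diagram.
  have hgen : (P.colimitsCardinalClosure κ').IsCardinalFilteredGenerator κ' := by
    refine ⟨P.colimitsCardinalClosure_le_isCardinalPresentable
      (hP.le_isCardinalPresentable.trans (isCardinalPresentable_monotone _ hκ.le)), fun X => ?_⟩
    obtain ⟨J, _, _, ⟨p⟩⟩ := hP.exists_colimitsOfShape X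
    obtain ⟨α, _, _, R, _⟩ := IsCardinalFiltered.exists_cardinal_directed J κ
    let Q : Set α → Prop := fun B => IsCardinalFiltered B κ ∧ HasCardinalLT B κ'
    have hQ (A : Set α) (hA : HasCardinalLT A κ') : ∃ B, A ⊆ B ∧ Q B :=
      -- The cofinal family can be all subsets of size `< κ`, by the choice of `κ'`.
      Cardinal.SharplyLT.exists_isCardinalFiltered_set_of_exists_cofinal hκ
        (fun Y hY => ⟨Set.univ, (hκ' Y hY).of_injective _ Subtype.val_injective,
          fun a => ⟨a, Set.mem_univ _, le_rfl⟩⟩) A hA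
    have (B : Subtype Q) : IsCardinalFiltered B.1 κ := B.2.1
    have (B : Subtype Q) : HasColimitsOfShape B.1 D :=
      HasCardinalFilteredColimits.hasColimitsOfShape D κ B.1
    have hfil : IsCardinalFiltered (Subtype Q) κ' :=
      isCardinalFiltered_preorder _ _ fun K f hK => by
        obtain ⟨B, hB, hB'⟩ := hQ (⋃ k, (f k).1)
          (hasCardinalLT_iUnion _ (by rwa [hasCardinalLT_iff_cardinal_mk_lt]) fun k => (f k).2.2)
        exact ⟨⟨B, hB'⟩, fun k => (Set.subset_iUnion (fun k => (f k).1) k).trans hB⟩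
    have := isFiltered_of_isCardinalFiltered (Subtype Q) κ'
    let F := R ⋙ p.diag
    obtain ⟨hc⟩ := nonempty_isColimit_subsetColimitCocone (F := F) (Q := Q)
      (c := p.cocone.whisker R) ((Functor.Final.isColimitWhiskerEquiv R _).symm p.isColimit)
      (fun B B' => ⟨IsFiltered.max B B', leOfHom (IsFiltered.leftToMax B B'),
        leOfHom (IsFiltered.rightToMax B B')⟩)
      (fun a => by
        obtain ⟨B, hB, hB'⟩ := hQ {a} (hasCardinalLT_of_finite _ _ aleph0_le)
        exact ⟨⟨B, hB'⟩, hB rfl⟩)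
    refine ⟨Subtype Q, inferInstance, hfil, ⟨{
      diag := subsetColimitFunctor F Q
      ι := (subsetColimitCocone Q (p.cocone.whisker R)).ι
      isColimit := hc
      prop_diag_obj := fun B => ?_ }⟩⟩
    have := P.isClosedUnderColimitsOfShape_colimitsCardinalClosure κ' B.1
      (hasCardinalLT_arrow_of_preorder aleph0_le B.2.2)
    exact ObjectProperty.prop_colimit _ _ fun b =>
      P.le_colimitsCardinalClosure κ' _ (p.prop_diag_obj _)
  have := hgen.hasCardinalFilteredGenerator
  constructor

end RaisingIndex

/-! ### Testing colimits and limits on a strong generator -/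

section StrongGenerators

universe v v' u'

variable {D : Type u} [Category.{v} D]

/-- Injectivity makes `f` a monomorphism because `P` is separating; surjectivity then makes it
invertible because `P` is strong. -/
theorem isIso_of_isStrongGenerator {P : ObjectProperty D} (hP : P.IsStrongGenerator) {X Y : D}
    (f : X ⟶ Y) (hf : ∀ G, P G → Function.Bijective fun g : G ⟶ X => g ≫ f) : IsIso f := by
  have : Mono f := ⟨fun g h e => hP.isSeparating _ _ fun G hG k => (hf G hG).1 (by simp [e])⟩
  exact hP.isIso_of_mono f fun G hG => (hf G hG).2

/-- Preservation of colimits can be tested on a strong generator whose objects corepresent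
functors preserving these colimits. -/
theorem preservesColimitsOfShape_of_isStrongGenerator {P : ObjectProperty D}
    (hP : P.IsStrongGenerator) {J : Type w} [SmallCategory J] [HasColimitsOfShape J D]
    {K : Type u'} [Category.{v'} K] (T : K ⥤ D)
    (h₁ : ∀ G, P G → PreservesColimitsOfShape J (coyoneda.obj (op G)))
    (h₂ : ∀ G, P G → PreservesColimitsOfShape J (T ⋙ coyoneda.obj (op G))) :
    PreservesColimitsOfShape J T where
  preservesColimit {F} := ⟨fun {c} hc => by
    let φ : colimit (F ⋙ T) ⟶ T.obj c.pt := colimit.desc (F ⋙ T) (T.mapCocone c)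
    have : IsIso φ := isIso_of_isStrongGenerator hP φ fun G hG => by
      have := h₁ G hG
      have := h₂ G hG
      let hd := isColimitOfPreserves (coyoneda.obj (op G)) (colimit.isColimit (F ⋙ T))
      let hc' := isColimitOfPreserves (T ⋙ coyoneda.obj (op G)) hc
      let e := hd.coconePointUniqueUpToIso hc'
      -- Both hom-functors preserve the colimit, so the image of `φ` is the canonical isomorphism
      -- between two colimits of one diagram.
      have he : e.hom = (coyoneda.obj (op G)).map φ := hd.hom_ext fun j => by
        rw [hd.comp_coconePointUniqueUpToIso_hom]
        refine Eq.trans ?_ ((coyoneda.obj (op G)).map_comp (colimit.ι (F ⋙ T) j) φ)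
        rw [colimit.ι_desc]
        rfl
      have : IsIso ((coyoneda.obj (op G)).map φ) := he ▸ inferInstance
      exact (isIso_iff_bijective ((coyoneda.obj (op G)).map φ)).1 this
    exact ⟨IsColimit.ofIsoColimit (colimit.isColimit (F ⋙ T))
      (Cocone.ext (asIso φ) fun j => colimit.ι_desc _ _)⟩⟩

/-- There is a regular cardinal above a given one for which all objects of
a small class of objects are presentable. -/
theorem exists_le_isCardinalPresentable [IsLocallyPresentable.{w} D] (P : ObjectProperty D)
    [ObjectProperty.Small.{w} P] (μ : Cardinal.{w}) :
    ∃ (κ : Cardinal.{w}) (_ : Fact κ.IsRegular), μ ≤ κ ∧ P ≤ isCardinalPresentable D κ := by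
  have pres : ∀ X : D, ∃ (κ : Cardinal.{w}) (_ : Fact κ.IsRegular), IsCardinalPresentable X κ :=
    fun X => (inferInstance : IsPresentable.{w} X).exists_cardinal
  choose k hk hk' using pres
  -- The extra point `none` carries the prescribed lower bound `μ`.
  let g : Option (Shrink.{w} (Subtype P)) → Cardinal.{w} :=
    fun o => o.elim μ fun s => k ((equivShrink _).symm s).1
  obtain ⟨κ, hκ, hlt⟩ :=
    HasCardinalLT.exists_regular_cardinal_forall.{w} fun i => (g i).ord.ToType
  have hle : ∀ i, g i ≤ κ := fun i =>
    le_of_lt (by simpa [hasCardinalLT_iff_cardinal_mk_lt] using hlt i)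
  have : Fact κ.IsRegular := ⟨hκ⟩
  refine ⟨κ, this, hle none, fun X hX => ?_⟩
  have := hle (some (equivShrink _ ⟨X, hX⟩))
  simp only [g, Option.elim_some, Equiv.symm_apply_apply] at this
  exact isCardinalPresentable_of_le (κ := k X) X this

/-- In a locally presentable category, a property of objects which holds for
a small strong generator and is closed under colimits holds for all objects. -/
theorem forall_of_isStrongGenerator [IsLocallyPresentable.{w} D] {P : ObjectProperty D}
    [ObjectProperty.Small.{w} P] (hP : P.IsStrongGenerator) (Q : ObjectProperty D)
    [Q.IsClosedUnderIsomorphisms]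
    (hQ : ∀ (J : Type w) [SmallCategory J], Q.IsClosedUnderColimitsOfShape J) (hPQ : P ≤ Q)
    (X : D) : Q X := by
  obtain ⟨κ₁, _, _⟩ := IsLocallyPresentable.exists_cardinal.{w} D
  obtain ⟨κ, _, hκ, hPκ⟩ := exists_le_isCardinalPresentable P κ₁
  have := IsCardinalLocallyPresentable.of_le D hκ
  obtain ⟨J, _, _, hX⟩ :=
    (isCardinalFilteredGenerator_isCardinalPresentable D κ).exists_colimitsOfShape X
  refine (hQ J).colimitsOfShape_le _ (ObjectProperty.colimitsOfShape_monotone J ?_ X hX)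
  -- `X` is a filtered colimit of `κ`-presentable objects, and these are exactly the closure of `P`
  -- under `κ`-small colimits.
  rw [IsStrongGenerator.colimitsCardinalClosure_eq_isCardinalPresentable hP hPκ]
  exact P.colimitsCardinalClosure_le κ (fun J _ _ => hQ J) hPQ

/-- In a locally presentable category, a cone is a limit if it has the universal property with
respect to the objects of a small strong generator. -/
theorem nonempty_isLimit_of_isStrongGenerator [IsLocallyPresentable.{w} D] {P : ObjectProperty D}
    [ObjectProperty.Small.{w} P] (hP : P.IsStrongGenerator)
    {J : Type u'} [Category.{v'} J] {F : J ⥤ D} (c : Cone F)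
    (hc : ∀ G, P G → ∀ π : (Functor.const J).obj G ⟶ F,
      ∃! g : G ⟶ c.pt, ∀ j, g ≫ c.π.app j = π.app j) :
    Nonempty (IsLimit c) := by
  let Q : ObjectProperty D := fun Z => ∀ π : (Functor.const J).obj Z ⟶ F,
    ∃! g : Z ⟶ c.pt, ∀ j, g ≫ c.π.app j = π.app j
  have : Q.IsClosedUnderIsomorphisms := ⟨fun {X Y} e hX π => by
    obtain ⟨g, hg, hg'⟩ := hX ((Functor.const J).map e.hom ≫ π)
    refine ⟨e.inv ≫ g, fun j => by simp [hg], fun g₁ hg₁ => ?_⟩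
    rw [← hg' (e.hom ≫ g₁) fun j => by simp [hg₁], Iso.inv_hom_id_assoc]⟩
  -- Uniqueness at each stage makes the induced maps compatible, so they glue over the colimit.
  have hQ (K : Type w) [SmallCategory K] : Q.IsClosedUnderColimitsOfShape K := ⟨by
    rintro X ⟨p⟩ π
    choose g hg hg' using fun k =>
      p.prop_diag_obj k ((Functor.const J).map (p.ι.app k) ≫ π)
    have hw {k k' : K} (f : k ⟶ k') : p.diag.map f ≫ g k' = g k :=
      hg' k _ fun j => by
        rw [Category.assoc, hg k' j]
        simp
    let t : Cocone p.diag :=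
      { pt := c.pt
        ι := { app := g, naturality := fun k k' f => by simp [hw] } }
    refine ⟨p.isColimit.desc t, fun j => p.isColimit.hom_ext fun k => ?_, fun g₁ hg₁ =>
      p.isColimit.hom_ext fun k => ?_⟩
    · rw [← Category.assoc, p.isColimit.fac]
      exact hg k j
    · rw [p.isColimit.fac]
      refine hg' k _ fun j => ?_
      rw [Category.assoc, hg₁]
      rfl⟩
  have h (Z : D) : Q Z := forall_of_isStrongGenerator hP Q hQ hc Z
  choose l hl hl' using h
  exact ⟨{
    lift := fun s => l s.pt s.π
    fac := fun s => hl s.pt s.π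
    uniq := fun s m hm => hl' s.pt s.π m hm }⟩

end StrongGenerators

/-! ### Underlying hom-sets as maps from the unit -/

section UnderlyingHom

variable {V : Type u} [Category.{w} V] [MonoidalCategory V]
  {C : Type u₁} [Category.{w} C] [EnrichedOrdinaryCategory V C]

theorem eHomEquiv_comp_whiskerLeft {X Y Z : C} (f : X ⟶ Y) (g : Y ⟶ Z) :
    eHomEquiv V (f ≫ g) = eHomEquiv V f ≫ eHomWhiskerLeft V X g := by
  rw [eHomEquiv_comp, eHomWhiskerLeft, rightUnitor_inv_naturality_assoc, tensorHom_def_assoc,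
    unitors_inv_equal]

/-- The natural bijection between morphisms in `C` and morphisms `𝟙_ V ⟶ C(X, Y)`. -/
def coyonedaUnderlyingIso (X : C) :
    coyoneda.obj (op X) ≅ (eHomFunctor V C).obj (op X) ⋙ coyoneda.obj (op (𝟙_ V)) :=
  NatIso.ofComponents (fun _ => (eHomEquiv V).toIso) fun g => by
    ext f
    exact eHomEquiv_comp_whiskerLeft (V := V) f g

end UnderlyingHom

/-! ### Universal property and functoriality of powers -/

section PowerHom

universe v

variable {V : Type u} [Category.{w} V] [MonoidalCategory V] [SymmetricCategory V]
  [MonoidalClosed V] {C : Type u₁} [Category.{w} C] [EnrichedOrdinaryCategory V C]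

/-- Morphisms into the power `P = G ⋔ X` correspond to morphisms out of `G`. -/
theorem bijective_powerHom {G : V} {P X : C} {ε : G ⟶ (EnrichedCategory.Hom P X : V)}
    (hε : IsPower ε) (B : C) :
    Function.Bijective fun f : B ⟶ P => ε ≫ eHomWhiskerRight V f X := by
  have := hε B
  have key (f : B ⟶ P) : ε ≫ eHomWhiskerRight V f X =
      (ρ_ G).inv ≫ MonoidalClosed.uncurry (eHomEquiv V f ≫ powerComparison ε B) := by
    rw [MonoidalClosed.uncurry_natural_left, powerComparison, MonoidalClosed.uncurry_curry,
      eHomWhiskerRight, BraidedCategory.braiding_naturality_right_assoc,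
      ← whisker_exchange_assoc, braiding_tensorUnit_right]
    simp
  -- Factor through `V₀(I, C(B, P)) ≅ V₀(I, [G, C(B, X)]) ≅ V₀(G ⊗ I, C(B, X))`.
  have h : (fun f : B ⟶ P => ε ≫ eHomWhiskerRight V f X) =
      (Iso.homCongr (ρ_ G) (Iso.refl _)) ∘ ((ihom.adjunction G).homEquiv (𝟙_ V) (B ⟶[V] X)).symm ∘
        (Iso.homCongr (Iso.refl _) (asIso (powerComparison ε B))) ∘ eHomEquiv V := by
    funext f
    rw [key]
    simp [MonoidalClosed.uncurry, Iso.homCongr]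
  rw [h]
  exact (Equiv.bijective _).comp
    ((Equiv.bijective _).comp ((Equiv.bijective _).comp (Equiv.bijective _)))

/-- The data which exhibits the functor `T' : K ⥤ C` as the pointwise power by `G` of the functor
`T : K ⥤ C`. -/
structure FunctorPower {K : Type u₂} [Category.{v} K] (G : V) (T' T : K ⥤ C) where
  /-- the counit of the power -/
  ε (k : K) : G ⟶ (EnrichedCategory.Hom (T'.obj k) (T.obj k) : V)
  isPower (k : K) : IsPower (ε k)
  naturality {k l : K} (f : k ⟶ l) :
    ε k ≫ eHomWhiskerLeft V (T'.obj k) (T.map f) =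
      ε l ≫ eHomWhiskerRight V (T'.map f) (T.obj l)

/-- The natural bijection `C(X, T'(k)) ≅ V(G, C(X, T(k)))` for a pointwise power `T'` of `T`. -/
noncomputable def FunctorPower.coyonedaIso {K : Type u₂} [Category.{v} K] {G : V} {T' T : K ⥤ C}
    (h : FunctorPower G T' T) (X : C) :
    T' ⋙ coyoneda.obj (op X) ≅ (T ⋙ (eHomFunctor V C).obj (op X)) ⋙ coyoneda.obj (op G) :=
  NatIso.ofComponents
    (fun k => (Equiv.ofBijective _ (bijective_powerHom (h.isPower k) X)).toIso)
    (fun {k k'} f => by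
      ext x
      change h.ε k' ≫ eHomWhiskerRight V (x ≫ T'.map f) (T.obj k') =
        (h.ε k ≫ eHomWhiskerRight V x (T.obj k)) ≫ eHomWhiskerLeft V X (T.map f)
      rw [eHomWhiskerRight_comp, ← Category.assoc, ← h.naturality, Category.assoc, Category.assoc,
        eHom_whisker_exchange])

/-- Powers by `G` are functorial. -/
theorem exists_functorPower {G : V}
    (hG : ∀ X : C, ∃ (P : C) (ε : G ⟶ (EnrichedCategory.Hom P X : V)), IsPower ε) :
    ∃ T : C ⥤ C, Nonempty (FunctorPower G T (𝟭 C)) := by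
  choose P ε hε using hG
  -- `m f` is the unique map making `ε` natural; uniqueness yields the functor laws.
  choose m hm using fun (X Y : C) (f : X ⟶ Y) =>
    (bijective_powerHom (hε Y) (P X)).2 (ε X ≫ eHomWhiskerLeft V (P X) f)
  let T : C ⥤ C :=
    { obj := P
      map := fun f => m _ _ f
      map_id := fun X => (bijective_powerHom (hε X) (P X)).1 ((hm _ _ _).trans (by simp))
      map_comp := fun {X Y Z} f g => (bijective_powerHom (hε Z) (P X)).1 ((hm _ _ _).trans (by
        have h₁ := hm _ _ f
        have h₂ := hm _ _ g
        dsimp at h₁ h₂ ⊢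
        rw [eHomWhiskerRight_comp, ← Category.assoc, h₂, Category.assoc, eHom_whisker_exchange,
          ← Category.assoc, h₁, eHomWhiskerLeft_comp, Category.assoc])) }
  exact ⟨T, ⟨{ ε := ε, isPower := hε, naturality := fun f => (hm _ _ f).symm }⟩⟩

/-- If `C` has powers by a strong generator, then `C(-, Y)` turns colimits into limits. -/
theorem preservesLimitsOfShape_eHomFunctor_flip [IsLocallyPresentable.{w} V] {𝒢 : ObjectProperty V}
    [ObjectProperty.Small.{w} 𝒢] (h𝒢 : 𝒢.IsStrongGenerator) (hC : HasPowersBy C 𝒢) (Y : C)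
    (J : Type u₂) [Category.{v} J] :
    PreservesLimitsOfShape J ((eHomFunctor V C).flip.obj Y) where
  preservesLimit {F} := ⟨fun {c} hc => nonempty_isLimit_of_isStrongGenerator h𝒢 _
    fun G hG π => by
      obtain ⟨P, ε, hε⟩ := hC G hG Y
      let q (j : J) : G ⟶ (EnrichedCategory.Hom (F.obj j).unop Y : V) := π.app j
      have hq {j j' : J} (f : j ⟶ j') : q j ≫ eHomWhiskerRight V (F.map f).unop Y = q j' :=
        (π.naturality f).symm.trans (Category.id_comp _)
      -- A cone from `G` over `C(F -, Y)` transposes to a cocone in `C₀` with point `G ⋔ Y`.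
      choose a ha using fun j => (bijective_powerHom hε (F.obj j).unop).2 (q j)
      dsimp only at ha
      have hw {j j' : J} (f : j ⟶ j') : (F.map f).unop ≫ a j = a j' :=
        (bijective_powerHom hε (F.obj j').unop).1 (by
          dsimp only
          rw [eHomWhiskerRight_comp, ← Category.assoc, ha, ha, hq])
      obtain ⟨t, ht, ht'⟩ : ∃ t : c.pt.unop ⟶ P, (∀ j, (c.π.app j).unop ≫ t = a j) ∧
          ∀ x : c.pt.unop ⟶ P, (∀ j, (c.π.app j).unop ≫ x = a j) → x = t := by
        let s : Cone F :=
          { pt := op P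
            π := { app := fun j => (a j).op
                   naturality := fun j j' f => Quiver.Hom.unop_inj (by simp [hw]) } }
        exact ⟨(hc.lift s).unop, fun j => Quiver.Hom.op_inj (hc.fac s j), fun x hx =>
          Quiver.Hom.op_inj (hc.uniq s x.op fun j => Quiver.Hom.unop_inj (hx j))⟩
      refine ⟨ε ≫ eHomWhiskerRight V t Y, fun j => ?_, fun g hg => ?_⟩
      · change (ε ≫ eHomWhiskerRight V t Y) ≫ eHomWhiskerRight V (c.π.app j).unop Y = q j
        rw [Category.assoc, ← eHomWhiskerRight_comp, ht, ha]
      · obtain ⟨x, rfl⟩ := (bijective_powerHom hε c.pt.unop).2 g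
        refine congrArg (fun t => ε ≫ eHomWhiskerRight V t Y) (ht' x fun j =>
          (bijective_powerHom hε (F.obj j).unop).1 ?_)
        have := hg j
        change (ε ≫ eHomWhiskerRight V x Y) ≫ eHomWhiskerRight V (c.π.app j).unop Y = q j at this
        dsimp only
        rw [ha, ← this, eHomWhiskerRight_comp, Category.assoc]⟩

end PowerHom

/-! ### Compatibility of a `V`-functor with whiskering -/

section UnderlyingFunctor

variable {V : Type u} [Category.{w} V] [MonoidalCategory V]
  {A : Type u₁} [EnrichedCategory V A] {C : Type u₂} [EnrichedCategory V C]

theorem eHomWhiskerLeft_map (U : EnrichedFunctor V A C) (X : ForgetEnrichment V A)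
    {Y Y' : ForgetEnrichment V A} (g : Y ⟶ Y') :
    eHomWhiskerLeft V X g ≫ U.map X Y' =
      U.map X Y ≫ eHomWhiskerLeft V (U.forget.obj X) (U.forget.map g) := by
  have (X Y Y' : A) (g : 𝟙_ V ⟶ (Y ⟶[V] Y')) :
      ((ρ_ _).inv ≫ _ ◁ g ≫ eComp V X Y Y') ≫ U.map X Y' =
        U.map X Y ≫ (ρ_ _).inv ≫ _ ◁ (g ≫ U.map Y Y') ≫
          eComp V (U.obj X) (U.obj Y) (U.obj Y') := by
    rw [Category.assoc, Category.assoc, U.map_comp, tensorHom_def'_assoc,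
      rightUnitor_inv_naturality_assoc, ← whisker_exchange_assoc,
      MonoidalCategory.whiskerLeft_comp_assoc]
  exact this X Y Y' g

theorem eHomWhiskerRight_map (U : EnrichedFunctor V A C) {X X' : ForgetEnrichment V A}
    (f : X ⟶ X') (Y : ForgetEnrichment V A) :
    eHomWhiskerRight V f Y ≫ U.map X Y =
      U.map X' Y ≫ eHomWhiskerRight V (U.forget.map f) (U.forget.obj Y) := by
  have (X X' Y : A) (f : 𝟙_ V ⟶ (X ⟶[V] X')) :
      ((λ_ _).inv ≫ f ▷ _ ≫ eComp V X X' Y) ≫ U.map X Y =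
        U.map X' Y ≫ (λ_ _).inv ≫ (f ≫ U.map X X') ▷ _ ≫
          eComp V (U.obj X) (U.obj X') (U.obj Y) := by
    rw [Category.assoc, Category.assoc, U.map_comp, tensorHom_def_assoc,
      leftUnitor_inv_naturality_assoc, whisker_exchange_assoc, comp_whiskerRight_assoc]
  exact this X X' Y f

end UnderlyingFunctor

/-! ### Conical colimits and powers in accessible `V`-categories -/

section AccessibleVCategories

variable {V : Type u} [Category.{w} V] [MonoidalCategory V] [SymmetricCategory V]
  [MonoidalClosed V] {A : Type u₁} [EnrichedCategory V A] {C : Type u₂} [EnrichedCategory V C]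

/-- If a `V`-functor preserves powers by `G`, its underlying functor maps pointwise powers
to pointwise powers. -/
def FunctorPower.map {𝒢 : ObjectProperty V} {U : EnrichedFunctor V A C}
    (hU : PreservesPowersBy U 𝒢) {G : V} (hG : 𝒢 G)
    {T : ForgetEnrichment V A ⥤ ForgetEnrichment V A}
    (h : FunctorPower G T (𝟭 _)) : FunctorPower G (T ⋙ U.forget) U.forget where
  ε X := h.ε X ≫ U.map (T.obj X) X
  isPower X := hU G hG _ _ _ (h.isPower X)
  naturality {X Y} f := by
    have h₁ := eHomWhiskerLeft_map U (T.obj X) f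
    have h₂ := eHomWhiskerRight_map U (T.map f) Y
    have h₃ : h.ε X ≫ eHomWhiskerLeft V (T.obj X) f =
      h.ε Y ≫ eHomWhiskerRight V (T.map f) Y := h.naturality f
    refine (Category.assoc _ _ _).trans ((congrArg (h.ε X ≫ ·) h₁.symm).trans ?_)
    refine Eq.trans ?_ ((congrArg (h.ε Y ≫ ·) h₂).trans (Category.assoc _ _ _).symm)
    exact (Category.assoc _ _ _).symm.trans ((congrArg (· ≫ U.map (T.obj X) Y) h₃).trans
      (Category.assoc _ _ _))

/-- If `C` has powers by a strong generator, all colimits in the underlying category are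
conical. -/
theorem isConicalColimit_of_isColimit [IsLocallyPresentable.{w} V] {𝒢 : ObjectProperty V}
    [ObjectProperty.Small.{w} 𝒢] (h𝒢 : 𝒢.IsStrongGenerator) (hC : HasPowersBy C 𝒢)
    {J : Type w} [SmallCategory J] {F : J ⥤ ForgetEnrichment V C} {c : Cocone F}
    (hc : IsColimit c) : IsConicalColimit V c where
  isColimit := ⟨hc⟩
  isColimit_homInto Y := by
    have := preservesLimitsOfShape_eHomFunctor_flip (C := ForgetEnrichment V C) h𝒢 hC Y Jᵒᵖ
    have : PreservesColimitsOfShape J (homInto V Y) :=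
      preservesColimitsOfShape_rightOp J ((eHomFunctor V (ForgetEnrichment V C)).flip.obj Y)
    exact ⟨isColimitOfPreserves (homInto V Y) hc⟩

/-- In an accessible `V`-category, powers by `G` commute with sufficiently filtered colimits. -/
theorem FunctorPower.preservesColimitsOfShape [IsLocallyPresentable.{w} V] {𝒢 : ObjectProperty V}
    [ObjectProperty.Small.{w} 𝒢] (h𝒢 : 𝒢.IsStrongGenerator) (hC : HasPowersBy C 𝒢)
    {κ : Cardinal.{w}} [Fact κ.IsRegular] (hunit : IsCardinalPresentable (𝟙_ V) κ)
    (hCacc : IsCardinalAccessibleVCategory V C κ)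
    {κ' : Cardinal.{w}} [Fact κ'.IsRegular] (hκ : κ ≤ κ')
    {K : Type u₁} [Category.{w} K] {G : V} [IsCardinalPresentable G κ']
    {T' T : K ⥤ ForgetEnrichment V C} (h : FunctorPower G T' T)
    (J : Type w) [SmallCategory J] [IsCardinalFiltered J κ'] [PreservesColimitsOfShape J T] :
    PreservesColimitsOfShape J T' := by
  -- Thus `C` is used only at its own index `κ`, which need not be raised.
  have : IsCardinalFiltered J κ := .of_le _ hκ
  obtain ⟨S, -, hS, hS'⟩ := hCacc.exists_generator
  have hfrom (X : ForgetEnrichment V C) (hX : S X) :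
      PreservesColimitsOfShape J ((eHomFunctor V (ForgetEnrichment V C)).obj (op X)) :=
    ⟨fun {F} => ⟨fun {c} hc => hS X hX J F c (isConicalColimit_of_isColimit h𝒢 hC hc)⟩⟩
  have : HasColimitsOfShape J (ForgetEnrichment V C) := ⟨fun F => by
    obtain ⟨c, hc⟩ := hCacc.exists_conicalColimit J F
    obtain ⟨hc⟩ := hc.isColimit
    exact ⟨⟨c, hc⟩⟩⟩
  have hgen : S.IsStrongGenerator := .mk_of_exists_colimitsOfShape.{w} fun X => by
    obtain ⟨J, _, _, F, c, hF, hc, rfl⟩ := hS' X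
    obtain ⟨hc⟩ := hc.isColimit
    exact ⟨J, inferInstance, ⟨{ diag := F, ι := c.ι, isColimit := hc, prop_diag_obj := hF }⟩⟩
  have := preservesColimitsOfShape_of_isCardinalPresentable G κ' J
  have := preservesColimitsOfShape_of_isCardinalPresentable (𝟙_ V) κ J
  refine preservesColimitsOfShape_of_isStrongGenerator hgen T' (fun X hX => ?_) (fun X hX => ?_)
  -- `C₀(X, -) ≅ V₀(I, C(X, -))`, with `I` `κ`-presentable.
  · have := hfrom X hX
    exact preservesColimitsOfShape_of_natIso (coyonedaUnderlyingIso (V := V) X).symm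
  -- `C₀(X, T' -) ≅ V₀(G, C(X, T -))`, with `G` `κ'`-presentable.
  · have := hfrom X hX
    exact preservesColimitsOfShape_of_natIso (h.coyonedaIso X).symm

end AccessibleVCategories

end EnrichedAccessibility

open CategoryTheory EnrichedAccessibility in
theorem mainTheorem7
    {V : Type u} [Category.{w} V] [MonoidalCategory V] [SymmetricCategory V] [MonoidalClosed V]
    (κ₀ : Cardinal.{w}) [Fact κ₀.IsRegular] (hκ₀ : IsBaseCardinal V κ₀)
    (𝒢 : ObjectProperty V) [ObjectProperty.Small.{w} 𝒢] (h𝒢 : 𝒢.IsStrongGenerator)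
    {A : Type u₁} [EnrichedCategory V A] {C : Type u₂} [EnrichedCategory V C]
    (hA : HasPowersBy A 𝒢) (hC : HasPowersBy C 𝒢)
    (U : EnrichedFunctor V A C) (hU : PreservesPowersBy U 𝒢)
    (hUcons : U.forget.ReflectsIsomorphisms)
    (hCacc : IsAccessibleVCategory V C κ₀)
    (hAacc : IsAccessibleCategory.{w} (ForgetEnrichment V A))
    (hUacc : U.forget.IsAccessible.{w}) :
    IsAccessibleVCategory V A κ₀ := by
  have := hκ₀.isCardinalLocallyPresentable
  have := hκ₀.isCardinalPresentable_unit
  have : IsLocallyPresentable.{w} V := ⟨κ₀, inferInstance, inferInstance⟩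
  obtain ⟨κ, _, hκ, hCκ⟩ := hCacc
  obtain ⟨ν, _, _⟩ := hUacc.exists_cardinal
  obtain ⟨μ, _, hμ, h𝒢μ⟩ := exists_le_isCardinalPresentable 𝒢 (max κ ν)
  obtain ⟨l, _, hl, _⟩ := exists_isCardinalAccessibleCategory_ge.{w} (ForgetEnrichment V A) μ
  have hκl : κ ≤ l := (le_max_left _ _).trans (hμ.trans hl)
  have : U.forget.IsCardinalAccessible l :=
    Functor.isCardinalAccessible_of_le _ ((le_max_right _ _).trans (hμ.trans hl))
  have hunit := isCardinalPresentable_of_le (MonoidalCategoryStruct.tensorUnit V) hκ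
  obtain ⟨S, _, hS⟩ :=
    HasCardinalFilteredGenerator.exists_small_generator.{w} (ForgetEnrichment V A) l
  refine ⟨l, inferInstance, hκ.trans hκl, ⟨fun J _ _ F => ?_, S, inferInstance, fun X hX => ?_,
    fun X => ?_⟩⟩
  · have := HasCardinalFilteredColimits.hasColimitsOfShape (ForgetEnrichment V A) l J
    exact ⟨_, isConicalColimit_of_isColimit h𝒢 hA (Limits.colimit.isColimit F)⟩
  · intro J _ _ F c hc
    obtain ⟨hc⟩ := hc.isColimit
    have := HasCardinalFilteredColimits.hasColimitsOfShape (ForgetEnrichment V A) l J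
    have := U.forget.preservesColimitsOfShape_of_isCardinalAccessible l J
    have : IsCardinalPresentable X l := hS.le_isCardinalPresentable _ hX
    have := preservesColimitsOfShape_of_isCardinalPresentable X l J
    have : Limits.PreservesColimitsOfShape J (homFrom V X) := by
      refine preservesColimitsOfShape_of_isStrongGenerator h𝒢 _ (fun G hG => ?_) (fun G hG => ?_)
      · have : IsCardinalPresentable G μ := h𝒢μ _ hG
        have : IsCardinalPresentable G l := isCardinalPresentable_of_le _ hl
        exact preservesColimitsOfShape_of_isCardinalPresentable G l J
      · have : IsCardinalPresentable G μ := h𝒢μ _ hG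
        have : IsCardinalPresentable G l := isCardinalPresentable_of_le _ hl
        obtain ⟨T, ⟨hT⟩⟩ := exists_functorPower (C := ForgetEnrichment V A) (hA G hG)
        have : Limits.PreservesColimitsOfShape J (T ⋙ U.forget) :=
          (hT.map hU hG).preservesColimitsOfShape h𝒢 hC hunit hCκ hκl J
        -- Colimits of shape `J` exist in `A₀` and `U₀` preserves them, so conservativity makes `U₀`
        -- reflect them.
        have := Limits.reflectsColimitsOfShape_of_reflectsIsomorphisms (J := J) (G := U.forget)
        have : Limits.PreservesColimitsOfShape J T :=
          Limits.preservesColimitsOfShape_of_reflects_of_preserves T U.forget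
        exact Limits.preservesColimitsOfShape_of_natIso (hT.coyonedaIso X)
    exact ⟨Limits.isColimitOfPreserves (homFrom V X) hc⟩
  · obtain ⟨J, _, _, ⟨p⟩⟩ := hS.exists_colimitsOfShape X
    exact ⟨J, inferInstance, inferInstance, p.diag, p.cocone, p.prop_diag_obj,
      isConicalColimit_of_isColimit h𝒢 hA p.isColimit, rfl⟩
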